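/- Let $G$ be a finite group. A set $A\subseteq G$ is called $k$-stable if there are no $a_1,\dots,a_k,b_1,\dots,b_k\in G$ such that $a_ib_j\in A$ if and only if $i\le j$. For $\eta>0$ put $\operatorname{Stab}_\eta(A)=\{x\in G:|Ax\mathbin{\triangle}A|\le\eta|G|\}$. Let $\exp(x)=2^x$ and let $\exp^{m}$ be its $m$-fold composition. For every $k$ there is a positive integer $C=C(k)$, depending only on $k$, such that the following hold for every finite group $G$, every $k$-stable set $A\subseteq G$ and every $0<\epsilon<1$. (a) There are a subgroup $H\le G$ of index at most $C\epsilon^{-C}$ and a set $D\subseteq G$ that is a union of left cosets of $H$ with $|A\mathbin{\triangle}D|<\epsilon|H|$, such that $H=\operatorname{Stab}_\eta(A)$ for some $\eta$ with $C^{-1}\epsilon^{C}\le\eta\le\epsilon$. Moreover, there are integers $1\le n\le C\epsilon^{-C}$ and $\ell\le\binom{n}{\lfloor\epsilon n\rfloor}$ and elements $g_1,\dots,g_n\in G$ such that $$H=\bigcup_{t=1}^{\ell}\bigcap_{i=1}^{n}X_{t,i},$$ where each $X_{t,i}$ is either $g_iA$ or $G\setminus g_iA$. (b) There are a normal subgroup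 $H\le G$ of index at most $\exp^{C}(\epsilon^{-1})$ and a set $D\subseteq G$ that is a union of cosets of $H$ with $|A\mathbin{\triangle}D|<\epsilon|H|$. Moreover, $H=\bigcap_{g\in G}gH_0g^{-1}$ for some subgroup $H_0\le G$ which is as in (a) but with iterated exponential bounds. That is, $H_0$ has index at most $\exp^{C}(\epsilon^{-1})$; there is a union $D_0$ of left cosets of $H_0$ with $|A\mathbin{\triangle}D_0|<\epsilon|H_0|$; $H_0=\operatorname{Stab}_\eta(A)$ for some $0<\eta\le\epsilon$ with $\eta^{-1}\le\exp^{C}(\epsilon^{-1})$; and there are integers $1\le n\le\exp^{C}(\epsilon^{-1})$ and $\ell\le\binom{n}{\lfloor\epsilon n\rfloor}$ and $g_1,\dots,g_n\in G$ such that $H_0=\bigcup_{t=1}^{\ell}\bigcap_{i=1}^{n}X_{t,i}$, where each $X_{t,i}$ is either $g_iA$ or $G\setminus g_iA$. -/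

import Mathlib

open scoped Pointwise

/-- `A ⊆ G` is `k`-stable: there are no `a₁, …, a_k, b₁, …, b_k ∈ G` such that
`aᵢ bⱼ ∈ A` if and only if `i ≤ j`. -/
def IsKStable {G : Type*} [Group G] (k : ℕ) (A : Set G) : Prop :=
  ¬ ∃ a b : Fin k → G, ∀ i j : Fin k, a i * b j ∈ A ↔ i ≤ j

/-- The stabilizer `Stab_η(A) = {x ∈ G : |Ax ∆ A| ≤ η |G|}`, for a finite group `G`. -/
def stab {G : Type*} [Group G] (η : ℝ) (A : Set G) : Set G :=
  {x : G | ((symmDiff ((fun a => a * x) '' A) A).ncard : ℝ) ≤ η * (Nat.card G : ℝ)}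

/-- `D` is a union of left cosets of `H`. -/
def IsUnionOfLeftCosets {G : Type*} [Group G] (H : Subgroup G) (D : Set G) : Prop :=
  ∃ S : Set G, D = ⋃ g ∈ S, g • (H : Set G)

/-- `H` has index at most `N`, and there is a union `D` of left cosets of `H`
with `|A ∆ D| < ε |H|`. -/
def ApproximatesWithIndex {G : Type*} [Group G] (ε N : ℝ) (A : Set G) (H : Subgroup G) : Prop :=
  (H.index : ℝ) ≤ N ∧
    ∃ D : Set G, IsUnionOfLeftCosets H D ∧
      ((symmDiff A D).ncard : ℝ) < ε * (Nat.card H : ℝ)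

/-- `S = ⋃_{t ≤ l} ⋂_{i ≤ n} X_{t,i}` for some `g₁, …, g_n ∈ G`, where each `X_{t,i}` is
either `gᵢ A` or its complement. -/
def IsTranslateCombination {G : Type*} [Group G] (n l : ℕ) (A S : Set G) : Prop :=
  ∃ (g : Fin n → G) (X : Fin l → Fin n → Set G),
    (∀ t i, X t i = g i • A ∨ X t i = (g i • A)ᶜ) ∧ S = ⋃ t, ⋂ i, X t i

/-- The `m`-fold iterate of base-2 exponentiation `x ↦ 2 ^ x`. -/
noncomputable def iterExp (m : ℕ) (x : ℝ) : ℝ :=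
  (fun y : ℝ => (2 : ℝ) ^ y)^[m] x

/-! Call a point moved by `x` if right translation by `x` changes its membership in `A`; `Stab_η(A)`
consists of the `x` moving at most `η|G|` points. Displacement is subadditive, so if two thresholds
differing by a factor of at least 2 give the same stabilizer, that stabilizer is a subgroup. Along
thresholds decreasing by factors of at least 4, a long run without coincidence would supply elements
with rapidly growing displacements. Their products form a deep binary tree for the relation `a * b ∈
A`, and by Hodges' lemma such a tree contains a ladder, contradicting stability. Hence a coincidence
occurs within a number of steps depending only on `k` (`IsKStable.exists_stab_eq`).

Let H be the subgroup at a coincidence of the scales 1/Y and 1/g(Y). Distinct cosets of H give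
translates of A at distance at least |G|/Y, so a Sauer–Shelah packing argument bounds the index
polynomially in Y (`IsKStable.index_le`). Elements of H move at most |G|/g(Y) points, so a majority
vote on each left coset gives an H-invariant D with |A ∆ D| ≤ 2|G|/g(Y).

For definability, an element outside H moves far more points than |A ∆ D|. A generic choice of test
points then separates H from any other coset, because too many errors at the test points would again
form a ladder (`IsKStable.exists_separating_coset`). So a set F of polynomial size separates H from
its complement, and H is the union of the patterns on F that it realizes, of which there are at most
(|F| + 1)^k.

Everything is uniform in the growth function g. A polynomial g gives (a). For (b), an iterated
exponential g beats the factorial of the index, so the same D still has small enough error relative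
to the normal core. -/

/-! ### Binary trees, ladders and stability -/

/-- The relation `R` has a full binary tree of depth `d` with nodes in `X` and leaves in `Y`. -/
def NodeTree {α β : Type*} (R : α → β → Prop) : ℕ → Set α → Set β → Prop
  | 0, _, Y => Y.Nonempty
  | d + 1, X, Y =>
    ∃ a ∈ X, NodeTree R d X {y ∈ Y | R a y} ∧ NodeTree R d X {y ∈ Y | ¬ R a y}

namespace NodeTree

variable {α β : Type*} {R : α → β → Prop}

theorem mono_right {d : ℕ} {X : Set α} {Y Y' : Set β} (h : NodeTree R d X Y) (hY : Y ⊆ Y') :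
    NodeTree R d X Y' := by
  induction d generalizing Y Y' with
  | zero => exact h.mono hY
  | succ d ih =>
    obtain ⟨a, ha, h₁, h₂⟩ := h
    exact ⟨a, ha, ih h₁ fun y hy => ⟨hY hy.1, hy.2⟩, ih h₂ fun y hy => ⟨hY hy.1, hy.2⟩⟩

theorem nonempty {d : ℕ} {X : Set α} {Y : Set β} (h : NodeTree R d X Y) : Y.Nonempty := by
  induction d generalizing Y with
  | zero => exact h
  | succ d ih =>
    obtain ⟨a, -, h₁, -⟩ := h
    exact (ih h₁).mono fun y hy => hy.1

/-- A Ramsey property: colouring the nodes yields a deep monochromatic tree. -/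
theorem node_ramsey {m n : ℕ} {X : Set α} {Y : Set β} (p : α → Prop)
    (h : NodeTree R (m + n) X Y) :
    NodeTree R m {a ∈ X | p a} Y ∨ NodeTree R n {a ∈ X | ¬ p a} Y := by
  induction hs : m + n generalizing m n Y with
  | zero =>
    obtain rfl : m = 0 := by omega
    exact Or.inl h.nonempty
  | succ s ih =>
    rcases m with _ | m
    · exact Or.inl h.nonempty
    rcases n with _ | n
    · exact Or.inr h.nonempty
    rw [hs] at h
    obtain ⟨a, ha, h₁, h₂⟩ := h
    by_cases hp : p a
    · rw [show s = m + (n + 1) by omega] at h₁ h₂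
      rcases ih h₁ (by omega) with h₁ | h₁
      · rcases ih h₂ (by omega) with h₂ | h₂
        · exact Or.inl ⟨a, ⟨ha, hp⟩, h₁, h₂⟩
        · exact Or.inr (h₂.mono_right fun y hy => hy.1)
      · exact Or.inr (h₁.mono_right fun y hy => hy.1)
    · rw [show s = (m + 1) + n by omega] at h₁ h₂
      rcases ih h₁ (by omega) with h₁ | h₁
      · exact Or.inl (h₁.mono_right fun y hy => hy.1)
      · rcases ih h₂ (by omega) with h₂ | h₂
        · exact Or.inl (h₂.mono_right fun y hy => hy.1)
        · exact Or.inr ⟨a, ⟨ha, hp⟩, h₁, h₂⟩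

end NodeTree

/-- Hodges' lemma: a deep binary tree yields a long ladder of one of two kinds. -/
theorem exists_ladder_of_nodeTree (p q : ℕ) :
    ∃ d : ℕ, ∀ {α β : Type*} {R : α → β → Prop} {X : Set α} {Y : Set β}, NodeTree R d X Y →
      (∃ (a : ℕ → α) (b : ℕ → β), (∀ i < p, a i ∈ X ∧ b i ∈ Y) ∧
        ∀ i < p, ∀ j < p, (R (a i) (b j) ↔ j ≤ i)) ∨
      (∃ (a : ℕ → α) (b : ℕ → β), (∀ i < q, a i ∈ X ∧ b i ∈ Y) ∧
        ∀ i < q, ∀ j < q, (R (a i) (b j) ↔ i < j)) := by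
  induction hs : p + q generalizing p q with
  | zero =>
    obtain ⟨rfl, rfl⟩ : p = 0 ∧ q = 0 := by omega
    -- Depth 1 rather than 0, so that the tree has a node to serve as the value of the sequence `a`,
    -- even though no index is tested.
    refine ⟨1, fun ⟨a, ha, h, _⟩ => Or.inl ⟨fun _ => a, fun _ => h.nonempty.some, ?_, ?_⟩⟩ <;>
      simp
  | succ s ih =>
    rcases p with _ | p
    · refine ⟨1, fun ⟨a, ha, h, _⟩ => Or.inl ⟨fun _ => a, fun _ => h.nonempty.some, ?_, ?_⟩⟩ <;>
        simp
    rcases q with _ | q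
    · refine ⟨1, fun ⟨a, ha, h, _⟩ => Or.inr ⟨fun _ => a, fun _ => h.nonempty.some, ?_, ?_⟩⟩ <;>
        simp
    obtain ⟨d₁, hd₁⟩ := ih p (q + 1) (by omega)
    obtain ⟨d₂, hd₂⟩ := ih (p + 1) q (by omega)
    refine ⟨(d₁ + 1) + (d₂ + 1), fun {α β R X Y} h => ?_⟩
    obtain ⟨y, hy⟩ := h.nonempty
    -- Colour the nodes by their relation to one fixed leaf `y`. The root `x` of a monochromatic
    -- tree, paired with `y`, becomes the first rung; the rest of the ladder comes from the subtree
    -- on which `x` has the opposite relation to the leaves.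
    rcases h.node_ramsey (fun a => R a y) with h | h
    · obtain ⟨x, ⟨hxX, hxy⟩, -, h⟩ := h
      rcases hd₁ h with ⟨a, b, hab, hR⟩ | ⟨a, b, hab, hR⟩
      · refine Or.inl ⟨fun i => Nat.casesOn i x a, fun i => Nat.casesOn i y b, ?_, ?_⟩
        · rintro (_ | i) hi
          · exact ⟨hxX, hy⟩
          · exact ⟨(hab i (by omega)).1.1, (hab i (by omega)).2.1⟩
        · rintro (_ | i) hi (_ | j) hj
          · simpa using hxy
          · simpa using (hab j (by omega)).2.2
          · simpa using (hab i (by omega)).1.2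
          · simpa using hR i (by omega) j (by omega)
      · exact Or.inr ⟨a, b, fun i hi => ⟨(hab i hi).1.1, (hab i hi).2.1⟩, hR⟩
    · obtain ⟨x, ⟨hxX, hxy⟩, h, -⟩ := h
      rcases hd₂ h with ⟨a, b, hab, hR⟩ | ⟨a, b, hab, hR⟩
      · exact Or.inl ⟨a, b, fun i hi => ⟨(hab i hi).1.1, (hab i hi).2.1⟩, hR⟩
      · refine Or.inr ⟨fun i => Nat.casesOn i x a, fun i => Nat.casesOn i y b, ?_, ?_⟩
        · rintro (_ | i) hi
          · exact ⟨hxX, hy⟩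
          · exact ⟨(hab i (by omega)).1.1, (hab i (by omega)).2.1⟩
        · rintro (_ | i) hi (_ | j) hj
          · simpa using hxy
          · simpa using (hab j (by omega)).2.2
          · simpa using (hab i (by omega)).1.2
          · simpa using hR i (by omega) j (by omega)

theorem IsKStable.no_ge_ladder {G : Type*} [Group G] {k : ℕ} {A : Set G} (hA : IsKStable k A)
    (a b : ℕ → G) : ¬ ∀ i < k, ∀ j < k, (a i * b j ∈ A ↔ j ≤ i) := fun h =>
  hA ⟨fun i => a i.rev, fun j => b j.rev, fun i j => by
    rw [h _ i.rev.isLt _ j.rev.isLt, ← Fin.le_def, Fin.rev_le_rev]⟩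

theorem IsKStable.no_nodeTree (k : ℕ) : ∃ d : ℕ, ∀ {G : Type*} [Group G] {A : Set G},
    IsKStable k A → ¬ NodeTree (fun a b : G => a * b ∈ A) d Set.univ Set.univ := by
  -- The strict ladder has one extra rung: shifting `b` by one turns `i < j + 1` into `i ≤ j`.
  obtain ⟨d, hd⟩ := exists_ladder_of_nodeTree k (k + 1)
  refine ⟨d, fun {G _ A} hA h => ?_⟩
  rcases hd h with ⟨a, b, -, hR⟩ | ⟨a, b, -, hR⟩
  · exact hA.no_ge_ladder a b hR
  · refine hA ⟨fun i => a i, fun j => b (j + 1), fun i j => ?_⟩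
    rw [hR _ (by omega) _ (by omega), Nat.lt_succ_iff, Fin.le_def]

/-! ### Displacement and approximate stabilizers -/

section Displacement

variable {G : Type*} [Group G]

/-- The set of elements whose membership in `A` is changed by right translation by `x`. -/
def movedSet (A : Set G) (x : G) : Set G := {c | ¬ (c * x ∈ A ↔ c ∈ A)}

theorem ncard_mul_right_preimage (S : Set G) (x : G) : {c | c * x ∈ S}.ncard = S.ncard := by
  rw [← Set.ncard_image_of_injective S (mul_left_injective x⁻¹)]
  congr 1
  ext c
  simp

theorem ncard_symmDiff_translate (A : Set G) (x : G) :
    (symmDiff ((fun a => a * x) '' A) A).ncard = (movedSet A x).ncard := by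
  rw [← ncard_mul_right_preimage _ x]
  congr 1
  ext c
  simp only [Set.mem_symmDiff, movedSet, Set.mem_ofPred_eq, Set.image_mul_right, Set.mem_preimage,
    mul_inv_cancel_right]
  tauto

theorem mem_stab {η : ℝ} {A : Set G} {x : G} :
    x ∈ stab η A ↔ ((movedSet A x).ncard : ℝ) ≤ η * Nat.card G := by
  rw [stab, Set.mem_ofPred_eq, ncard_symmDiff_translate]

theorem ncard_movedSet_one (A : Set G) : (movedSet A 1).ncard = 0 := by
  simp [movedSet]

theorem ncard_movedSet_inv (A : Set G) (x : G) :
    (movedSet A x⁻¹).ncard = (movedSet A x).ncard := by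
  rw [← ncard_mul_right_preimage _ x]
  congr 1
  ext c
  simp [movedSet, iff_comm]

theorem ncard_movedSet_mul_le [Finite G] (A : Set G) (x y : G) :
    (movedSet A (x * y)).ncard ≤ (movedSet A x).ncard + (movedSet A y).ncard := by
  rw [← ncard_mul_right_preimage (movedSet A y) x]
  refine (Set.ncard_le_ncard (fun c hc => ?_) (Set.toFinite _)).trans (Set.ncard_union_le _ _)
  simp only [movedSet, Set.mem_ofPred_eq, Set.mem_union, ← mul_assoc] at hc ⊢
  tauto

theorem stab_mono {η η' : ℝ} (h : η ≤ η') (A : Set G) : stab η A ⊆ stab η' A := fun x hx => by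
  rw [mem_stab] at hx ⊢
  exact hx.trans (by gcongr)

/-- Two elements of the smaller stabilizer have a product of displacement at most `2 * η'`, by the
triangle inequality; the coincidence of the two stabilizers turns this into closure under
multiplication. -/
theorem exists_subgroup_eq_stab [Finite G] {η η' : ℝ} {A : Set G} (h₀ : 0 ≤ η')
    (hη : 2 * η' ≤ η) (h : stab η A = stab η' A) : ∃ H : Subgroup G, (H : Set G) = stab η A := by
  refine ⟨{ carrier := stab η A, mul_mem' := ?_, one_mem' := ?_, inv_mem' := ?_ }, rfl⟩
  · intro x y hx hy
    rw [h, mem_stab] at hx hy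
    rw [mem_stab]
    have := ncard_movedSet_mul_le A x y
    calc ((movedSet A (x * y)).ncard : ℝ) ≤ (movedSet A x).ncard + (movedSet A y).ncard := by
          exact_mod_cast this
      _ ≤ 2 * η' * Nat.card G := by linarith
      _ ≤ η * Nat.card G := by gcongr
  · rw [mem_stab, ncard_movedSet_one]
    have : 0 ≤ η := by linarith
    simpa using mul_nonneg this (Nat.cast_nonneg (α := ℝ) (Nat.card G))
  · intro x hx
    rw [mem_stab] at hx ⊢
    rwa [ncard_movedSet_inv]

end Displacement

/-! ### Coincidence of stabilizers at two scales -/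

section Branches

variable {G : Type*} [Group G]

/-- The products `x (r - 1) ^ e (r - 1) * ⋯ * x 0 ^ e 0` with exponents in `{0, 1}`. -/
def branches (x : ℕ → G) : ℕ → Set G
  | 0 => {1}
  | r + 1 => branches x r ∪ {y | ∃ y' ∈ branches x r, y = x r * y'}

/-- If `x r * y'` moves `c`, then either `x r` moves `c` or `y'` moves `c * x r`. -/
theorem ncard_moved_branches_succ_le [Finite G] (A : Set G) (x : ℕ → G) (r : ℕ) :
    {c | ∃ y ∈ branches x (r + 1), c ∈ movedSet A y}.ncard ≤
      2 * {c | ∃ y ∈ branches x r, c ∈ movedSet A y}.ncard + (movedSet A (x r)).ncard := by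
  set U := {c | ∃ y ∈ branches x r, c ∈ movedSet A y} with hU
  have hsub : {c | ∃ y ∈ branches x (r + 1), c ∈ movedSet A y} ⊆
      (U ∪ {c | c * x r ∈ U}) ∪ movedSet A (x r) := by
    rintro c ⟨y, hy | ⟨y', hy', rfl⟩, hc⟩
    · exact Or.inl (Or.inl ⟨y, hy, hc⟩)
    · by_cases hm : c ∈ movedSet A (x r)
      · exact Or.inr hm
      · refine Or.inl (Or.inr ⟨y', hy', ?_⟩)
        simp only [movedSet, Set.mem_ofPred_eq, ← mul_assoc] at hc hm ⊢
        tauto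
  calc _ ≤ _ := Set.ncard_le_ncard hsub (Set.toFinite _)
    _ ≤ (U ∪ {c | c * x r ∈ U}).ncard + _ := Set.ncard_union_le _ _
    _ ≤ (U.ncard + {c | c * x r ∈ U}.ncard) + _ := by gcongr; exact Set.ncard_union_le _ _
    _ = _ := by rw [ncard_mul_right_preimage]; ring

/-- Since displacements more than quadruple, `x r` moves more than twice as many points as all
products of the earlier elements together. So some `c` is moved by `x r` while neither `c` nor `c *
x r` is moved by any earlier product. The node `c * z⁻¹` then separates the leaves `z * y` from the
leaves `z * x r * y`. -/
theorem nodeTree_branches [Finite G] {A : Set G} {x : ℕ → G} {n : ℕ}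
    (h₀ : 0 < n → 0 < (movedSet A (x 0)).ncard)
    (h : ∀ r, r + 1 < n → 4 * (movedSet A (x r)).ncard < (movedSet A (x (r + 1))).ncard) (z : G) :
    NodeTree (fun a b : G => a * b ∈ A) n Set.univ {w | ∃ y ∈ branches x n, w = z * y} := by
  have key : ∀ r < n, 2 * {c | ∃ y ∈ branches x r, c ∈ movedSet A y}.ncard <
      (movedSet A (x r)).ncard := by
    intro r
    induction r with
    | zero =>
      intro hr
      have : {c | ∃ y ∈ branches x 0, c ∈ movedSet A y} = ∅ := by
        ext c
        simp [branches, movedSet]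
      rw [this]
      simpa using h₀ hr
    | succ r ih =>
      intro hr
      have h₁ := ih (by omega)
      have h₂ := h r hr
      have h₃ := ncard_moved_branches_succ_le A x r
      omega
  suffices ∀ r ≤ n, ∀ z, NodeTree (fun a b : G => a * b ∈ A) r Set.univ
      {w | ∃ y ∈ branches x r, w = z * y} from this n le_rfl z
  intro r
  induction r with
  | zero => exact fun _ z => ⟨z * 1, 1, rfl, rfl⟩
  | succ r ih =>
    intro hr z
    set U := {c | ∃ y ∈ branches x r, c ∈ movedSet A y} with hU
    obtain ⟨c, hc, hcU⟩ : ∃ c ∈ movedSet A (x r), c ∉ U ∪ {c | c * x r ∈ U} := by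
      refine Set.exists_mem_notMem_of_ncard_lt_ncard ?_
      have h₁ : 2 * U.ncard < _ := key r (by omega)
      have h₂ := Set.ncard_union_le U {c | c * x r ∈ U}
      rw [ncard_mul_right_preimage] at h₂
      omega
    have h₁ : ∀ y ∈ branches x r, (c * z⁻¹ * (z * y) ∈ A ↔ c ∈ A) := by
      intro y hy
      by_contra hne
      exact hcU (Or.inl ⟨y, hy, by simpa [movedSet, mul_assoc] using hne⟩)
    have h₂ : ∀ y ∈ branches x r, (c * z⁻¹ * (z * x r * y) ∈ A ↔ c * x r ∈ A) := by
      intro y hy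
      by_contra hne
      exact hcU (Or.inr ⟨y, hy, by simpa [movedSet, mul_assoc] using hne⟩)
    have hz₁ := ih (by omega) z
    have hz₂ := ih (by omega) (z * x r)
    simp only [movedSet, Set.mem_ofPred_eq] at hc
    by_cases hcA : c ∈ A
    · refine ⟨c * z⁻¹, trivial, hz₁.mono_right ?_, hz₂.mono_right ?_⟩
      · rintro w ⟨y, hy, rfl⟩
        exact ⟨⟨y, Or.inl hy, rfl⟩, (h₁ y hy).2 hcA⟩
      · rintro w ⟨y, hy, rfl⟩
        exact ⟨⟨x r * y, Or.inr ⟨y, hy, rfl⟩, mul_assoc _ _ _⟩, fun hw => by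
          have := (h₂ y hy).1 hw
          tauto⟩
    · refine ⟨c * z⁻¹, trivial, hz₂.mono_right ?_, hz₁.mono_right ?_⟩
      · rintro w ⟨y, hy, rfl⟩
        exact ⟨⟨x r * y, Or.inr ⟨y, hy, rfl⟩, mul_assoc _ _ _⟩, (h₂ y hy).2 (by tauto)⟩
      · rintro w ⟨y, hy, rfl⟩
        exact ⟨⟨y, Or.inl hy, rfl⟩, fun hw => hcA ((h₁ y hy).1 hw)⟩

/-- Along a rapidly decreasing sequence of thresholds, the stabilizers of a stable set repeat. -/
theorem IsKStable.exists_stab_eq (k : ℕ) : ∃ n : ℕ, ∀ {G : Type*} [Group G] [Finite G]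
    {A : Set G}, IsKStable k A → ∀ η : ℕ → ℝ, (∀ j, 0 ≤ η j) → (∀ j, 4 * η (j + 1) ≤ η j) →
      ∃ j < n, stab (η j) A = stab (η (j + 1)) A := by
  obtain ⟨d, hd⟩ := IsKStable.no_nodeTree k
  refine ⟨2 * d, fun {G _ _ A} hA η h₀ h => ?_⟩
  by_contra! hne
  -- Only every other gap is used: the gap from `η (2 * j + 1)` to `η (2 * j + 2)` supplies the
  -- factor 4 between consecutive displacements. The order is reversed below to make them increase.
  have hx : ∀ j, ∃ x : G, j < d → x ∈ stab (η (2 * j)) A ∧ x ∉ stab (η (2 * j + 1)) A := by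
    intro j
    by_cases hj : j < d
    · have hsub : stab (η (2 * j + 1)) A ⊆ stab (η (2 * j)) A :=
        stab_mono (by linarith [h (2 * j), h₀ (2 * j + 1)]) A
      obtain ⟨x, hx⟩ := Set.not_subset.1 fun hs => hne (2 * j) (by omega) (hs.antisymm hsub)
      exact ⟨x, fun _ => hx⟩
    · exact ⟨1, fun hj' => absurd hj' hj⟩
  choose x hx using hx
  have hN : (0 : ℝ) ≤ Nat.card G := Nat.cast_nonneg _
  refine hd hA ((nodeTree_branches (x := fun r => x (d - 1 - r)) (n := d) ?_ ?_ 1).mono_right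
    (Set.subset_univ _))
  · intro hd0
    have h₁ := (hx (d - 1 - 0) (by omega)).2
    rw [mem_stab, not_le] at h₁
    exact_mod_cast (mul_nonneg (h₀ _) hN).trans_lt h₁
  · intro r hr
    have h₁ := (hx (d - 1 - r) (by omega)).1
    have h₂ := (hx (d - 1 - (r + 1)) (by omega)).2
    rw [mem_stab] at h₁ h₂
    rw [not_le] at h₂
    have h₃ := h (2 * (d - 1 - (r + 1)) + 1)
    rw [show 2 * (d - 1 - (r + 1)) + 1 + 1 = 2 * (d - 1 - r) by omega] at h₃
    have h₄ := mul_le_mul_of_nonneg_right h₃ hN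
    have : (4 * (movedSet A (x (d - 1 - r))).ncard : ℝ) <
        (movedSet A (x (d - 1 - (r + 1)))).ncard := by linarith
    exact_mod_cast this

end Branches

/-! ### Packing bound for the index -/

section Packing

variable {G : Type*} [Group G]

open scoped Classical in
/-- Sauer–Shelah for stable sets: the translates of a `k`-stable set cut out at most
`(|F| + 1) ^ k` subsets of `F`. -/
theorem IsKStable.card_image_filter_le {k : ℕ} {A : Set G} (hA : IsKStable k A) (F Y : Finset G) :
    (Y.image fun y => F.filter fun a => a * y ∈ A).card ≤ (F.card + 1) ^ k := by
  set 𝒜 := Y.image fun y => F.filter fun a => a * y ∈ A with h𝒜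
  have hsub : 𝒜.shatterer ⊆ (Finset.range (k + 1)).biUnion fun j => F.powersetCard j := by
    intro S hS
    rw [Finset.mem_shatterer] at hS
    have hSF : S ⊆ F := by
      obtain ⟨T, hT, hST⟩ := hS.exists_superset
      obtain ⟨y, -, rfl⟩ := Finset.mem_image.1 hT
      exact hST.trans (Finset.filter_subset _ _)
    have hcard : S.card ≤ k := by
      by_contra! hk
      obtain ⟨S', hS', hk'⟩ := Finset.exists_subset_card_eq hk.le
      let e := S'.equivFinOfCardEq hk'
      -- A shattered set realizes all its initial segments as traces, which is a ladder of length
      -- `k`.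
      have hb : ∀ j : Fin k, ∃ y : G, ∀ i : Fin k, ((e.symm i : G) * y ∈ A ↔ i ≤ j) := by
        intro j
        obtain ⟨T, hT, hST⟩ := (hS.mono_right hS')
          (Finset.filter_subset (fun a => ∃ i ≤ j, (e.symm i : G) = a) S')
        obtain ⟨y, -, rfl⟩ := Finset.mem_image.1 hT
        refine ⟨y, fun i => ?_⟩
        have hi : (e.symm i : G) ∈ S' := (e.symm i).2
        have := Finset.ext_iff.1 hST (e.symm i)
        simp only [Finset.mem_inter, Finset.mem_filter, hi, hSF (hS' hi), true_and] at this
        rw [this]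
        constructor
        · rintro ⟨i', hi', h⟩
          rwa [← e.symm.injective (Subtype.ext h)]
        · exact fun h => ⟨i, h, rfl⟩
      choose b hb using hb
      exact hA ⟨fun i => e.symm i, b, fun i j => hb j i⟩
    exact Finset.mem_biUnion.2
      ⟨S.card, Finset.mem_range.2 (by omega), Finset.mem_powersetCard.2 ⟨hSF, rfl⟩⟩
  calc 𝒜.card ≤ 𝒜.shatterer.card := Finset.card_le_card_shatterer 𝒜
    _ ≤ _ := Finset.card_le_card hsub
    _ ≤ ∑ j ∈ Finset.range (k + 1), (F.powersetCard j).card := Finset.card_biUnion_le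
    _ ≤ ∑ j ∈ Finset.range (k + 1), F.card ^ j * 1 ^ (k - j) * k.choose j := by
      refine Finset.sum_le_sum fun j hj => ?_
      rw [Finset.card_powersetCard, one_pow, mul_one]
      have : 0 < k.choose j := Nat.choose_pos (by simpa [Nat.lt_succ_iff] using hj)
      exact (Nat.choose_le_pow _ _).trans (Nat.le_mul_of_pos_right _ this)
    _ = (F.card + 1) ^ k := (add_pow _ _ _).symm

/-- A greedy form of random sampling: double counting shows that some point separates at least a
proportion `c` of the pairs not yet separated. -/
theorem exists_separating_finset [Finite G] (A : Set G) (Y : Finset G) {c : ℝ}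
    (hY : ∀ y ∈ Y, ∀ y' ∈ Y, y ≠ y' → c * Nat.card G ≤ {a | ¬ (a * y ∈ A ↔ a * y' ∈ A)}.ncard)
    (hc : c ≤ 1) (m : ℕ) :
    ∃ F : Finset G, F.card ≤ m ∧
      ({p : G × G | p.1 ∈ Y ∧ p.2 ∈ Y ∧ p.1 ≠ p.2 ∧
        ∀ a ∈ F, (a * p.1 ∈ A ↔ a * p.2 ∈ A)}.ncard : ℝ) ≤ (1 - c) ^ m * (Y.card : ℝ) ^ 2 := by
  classical
  have := Fintype.ofFinite G
  induction m with
  | zero =>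
    refine ⟨∅, by simp, ?_⟩
    have : {p : G × G | p.1 ∈ Y ∧ p.2 ∈ Y ∧ p.1 ≠ p.2 ∧
        ∀ a ∈ (∅ : Finset G), (a * p.1 ∈ A ↔ a * p.2 ∈ A)} ⊆ ((Y ×ˢ Y : Finset (G × G)) : Set _) :=
      fun p hp => by simpa using ⟨hp.1, hp.2.1⟩
    have := Set.ncard_le_ncard this (Set.toFinite _)
    rw [Set.ncard_coe_finset, Finset.card_product] at this
    rw [pow_zero, one_mul, sq]
    exact_mod_cast this
  | succ m ih =>
    obtain ⟨F, hF, hP⟩ := ih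
    set P := Finset.univ.filter fun p : G × G => p.1 ∈ Y ∧ p.2 ∈ Y ∧ p.1 ≠ p.2 ∧
        ∀ a ∈ F, (a * p.1 ∈ A ↔ a * p.2 ∈ A) with hPdef
    have hPcard : {p : G × G | p.1 ∈ Y ∧ p.2 ∈ Y ∧ p.1 ≠ p.2 ∧
        ∀ a ∈ F, (a * p.1 ∈ A ↔ a * p.2 ∈ A)}.ncard = P.card := by
      rw [← Set.ncard_coe_finset]
      congr 1
      ext p
      simp [hPdef]
    rw [hPcard] at hP
    have hdouble : ∑ a : G, (P.filter fun p => ¬ (a * p.1 ∈ A ↔ a * p.2 ∈ A)).card =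
        ∑ p ∈ P, (Finset.univ.filter fun a : G => ¬ (a * p.1 ∈ A ↔ a * p.2 ∈ A)).card := by
      simp only [Finset.card_filter]
      exact Finset.sum_comm
    have hlow : ∑ _a : G, c * P.card ≤
        ∑ a : G, ((P.filter fun p => ¬ (a * p.1 ∈ A ↔ a * p.2 ∈ A)).card : ℝ) := by
      rw [← Nat.cast_sum, hdouble, Nat.cast_sum]
      calc ∑ _a : G, c * (P.card : ℝ) = ∑ _p ∈ P, c * Nat.card G := by
            simp [Nat.card_eq_fintype_card]; ring
        _ ≤ _ := Finset.sum_le_sum fun p hp => by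
            simp only [hPdef, Finset.mem_filter, Finset.mem_univ, true_and] at hp
            refine (hY p.1 hp.1 p.2 hp.2.1 hp.2.2.1).trans (le_of_eq ?_)
            rw [← Set.ncard_coe_finset]
            congr 2
            ext a
            simp
    obtain ⟨a, -, ha⟩ := Finset.exists_le_of_sum_le Finset.univ_nonempty hlow
    refine ⟨insert a F, (Finset.card_insert_le _ _).trans (by omega), ?_⟩
    have hnew : {p : G × G | p.1 ∈ Y ∧ p.2 ∈ Y ∧ p.1 ≠ p.2 ∧
        ∀ a' ∈ insert a F, (a' * p.1 ∈ A ↔ a' * p.2 ∈ A)}.ncard =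
        (P.filter fun p => (a * p.1 ∈ A ↔ a * p.2 ∈ A)).card := by
      rw [← Set.ncard_coe_finset]
      congr 1
      ext p
      simp [hPdef]
      tauto
    rw [hnew]
    have hsplit := Finset.card_filter_add_card_filter_not (s := P)
      (fun p => (a * p.1 ∈ A ↔ a * p.2 ∈ A))
    have hsplit' : ((P.filter fun p => (a * p.1 ∈ A ↔ a * p.2 ∈ A)).card : ℝ) +
      (P.filter fun p => ¬ (a * p.1 ∈ A ↔ a * p.2 ∈ A)).card = P.card := by exact_mod_cast hsplit
    calc _ ≤ (1 - c) * P.card := by linarith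
      _ ≤ (1 - c) * ((1 - c) ^ m * (Y.card : ℝ) ^ 2) := by gcongr
      _ = _ := by ring

/-- With `s = N ^ (1 / (2k))`, the bound `log N ≤ 2 * k * s` makes the right-hand side at most a
constant times `s ^ k`, the square root of `N`, which can be cancelled. -/
theorem le_of_le_log_pow {k : ℕ} (hk : 1 ≤ k) {N c : ℝ} (hN : 1 ≤ N) (hc : 0 < c) (hc1 : c ≤ 1)
    (h : N ≤ (2 * Real.log N / c + 2) ^ k) : N ≤ ((4 * k + 2) / c) ^ (2 * k) := by
  have hk0 : (0 : ℝ) < k := by exact_mod_cast hk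
  set s := N ^ (1 / (2 * k : ℝ)) with hs
  have hs1 : 1 ≤ s := Real.one_le_rpow hN (by positivity)
  have hlog : Real.log N ≤ 2 * k * s := by
    have := Real.log_le_rpow_div (x := N) (by linarith) (ε := 1 / (2 * k)) (by positivity)
    calc _ ≤ _ := this
      _ = _ := by rw [hs]; field_simp
  have hsN : s ^ (2 * k) = N := by
    rw [hs, ← Real.rpow_natCast, ← Real.rpow_mul (by linarith)]
    push_cast
    rw [one_div, inv_mul_cancel₀ (by positivity), Real.rpow_one]
  have hlog0 : 0 ≤ Real.log N := Real.log_nonneg hN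
  have hbase : 2 * Real.log N / c + 2 ≤ (4 * k + 2) / c * s := by
    have : 2 ≤ 2 / c * s := by
      have : 2 ≤ 2 / c := by rw [le_div_iff₀ hc]; linarith
      nlinarith
    calc 2 * Real.log N / c + 2 ≤ 2 * (2 * k * s) / c + 2 / c * s := by gcongr
      _ = _ := by ring
  have h₁ : N ≤ ((4 * k + 2) / c) ^ k * s ^ k := by
    rw [← mul_pow]
    exact h.trans (by gcongr)
  have h₂ : s ^ k ≤ ((4 * k + 2) / c) ^ k := by
    rw [← hsN, two_mul, pow_add] at h₁
    exact le_of_mul_le_mul_right h₁ (by positivity)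
  rw [← hsN, two_mul, pow_add, pow_add]
  gcongr

/-- Translates of a stable set that are pairwise far apart are few. -/
theorem IsKStable.card_le_of_separated [Finite G] {k : ℕ} {A : Set G} (hA : IsKStable k A)
    (Y : Finset G) {c : ℝ} (hc : 0 < c) (hc1 : c ≤ 1)
    (hY : ∀ y ∈ Y, ∀ y' ∈ Y, y ≠ y' → c * Nat.card G ≤ {a | ¬ (a * y ∈ A ↔ a * y' ∈ A)}.ncard) :
    (Y.card : ℝ) ≤ ((4 * k + 2) / c) ^ (2 * k) := by
  classical
  have hk : 1 ≤ k := by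
    by_contra! hk
    obtain rfl : k = 0 := by omega
    exact hA ⟨fun _ => 1, fun _ => 1, fun i => i.elim0⟩
  rcases Y.eq_empty_or_nonempty with rfl | hne
  · simp only [Finset.card_empty, Nat.cast_zero]
    positivity
  have hN : (1 : ℝ) ≤ Y.card := by exact_mod_cast hne.card_pos
  have hlog0 : 0 ≤ Real.log Y.card := Real.log_nonneg hN
  refine le_of_le_log_pow hk hN hc hc1 ?_
  -- Chosen so that `(1 - c) ^ m * |Y| ^ 2 < 1`, which leaves no unseparated pair.
  set m := ⌊2 * Real.log Y.card / c⌋₊ + 1 with hm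
  have hm1 : 2 * Real.log Y.card / c < m := by
    rw [hm]; push_cast; exact Nat.lt_floor_add_one _
  have hm2 : (m : ℝ) ≤ 2 * Real.log Y.card / c + 1 := by
    rw [hm]; push_cast
    gcongr
    exact Nat.floor_le (by positivity)
  obtain ⟨F, hF, hP⟩ := exists_separating_finset A Y hY hc1 m
  have hlt : (1 - c) ^ m * (Y.card : ℝ) ^ 2 < 1 := by
    have h₁ : (1 - c) ^ m ≤ Real.exp (-c * m) := by
      rw [mul_comm, Real.exp_nat_mul]
      have := Real.add_one_le_exp (-c)
      exact pow_le_pow_left₀ (by linarith) (by linarith) m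
    have h₂ : (Y.card : ℝ) ^ 2 = Real.exp (2 * Real.log Y.card) := by
      rw [show (2 : ℝ) = (2 : ℕ) by norm_num, Real.exp_nat_mul, Real.exp_log (by linarith)]
    calc _ ≤ Real.exp (-c * m) * Real.exp (2 * Real.log Y.card) := by rw [h₂]; gcongr
      _ = Real.exp (2 * Real.log Y.card - m * c) := by rw [← Real.exp_add]; congr 1; ring
      _ < 1 := by
        rw [Real.exp_lt_one_iff, sub_neg]
        rwa [div_lt_iff₀ hc] at hm1
  have hemp : {p : G × G | p.1 ∈ Y ∧ p.2 ∈ Y ∧ p.1 ≠ p.2 ∧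
      ∀ a ∈ F, (a * p.1 ∈ A ↔ a * p.2 ∈ A)} = ∅ := by
    rw [← Set.ncard_eq_zero (Set.toFinite _)]
    have := hP.trans_lt hlt
    exact_mod_cast Nat.lt_one_iff.1 (by exact_mod_cast this)
  have hinj : Set.InjOn (fun y => F.filter fun a => a * y ∈ A) Y := by
    intro y hy y' hy' heq
    by_contra hne
    have : (y, y') ∈ (∅ : Set (G × G)) := by
      rw [← hemp]
      refine ⟨hy, hy', hne, fun a ha => ?_⟩
      have := Finset.ext_iff.1 heq a
      simpa [ha] using this
    exact this
  have hcard := hA.card_image_filter_le F Y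
  rw [Finset.card_image_of_injOn hinj] at hcard
  calc (Y.card : ℝ) ≤ ((F.card : ℝ) + 1) ^ k := by exact_mod_cast hcard
    _ ≤ (2 * Real.log Y.card / c + 2) ^ k := by
      have : (F.card : ℝ) ≤ m := by exact_mod_cast hF
      exact pow_le_pow_left₀ (by positivity) (by linarith) k

theorem ncard_separators (A : Set G) (y y' : G) :
    {a | ¬ (a * y ∈ A ↔ a * y' ∈ A)}.ncard = (movedSet A (y⁻¹ * y')).ncard := by
  rw [← ncard_mul_right_preimage (movedSet A _) y]
  congr 1
  ext a
  simp only [movedSet, Set.mem_ofPred_eq, mul_assoc, mul_inv_cancel_left]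
  tauto

/-- Representatives of distinct left cosets differ by an element outside the stabilizer, so they are
separated at distance `η` and the packing bound applies. -/
theorem IsKStable.index_le [Finite G] {k : ℕ} {A : Set G} (hA : IsKStable k A) {η : ℝ}
    (hη : 0 < η) (hη1 : η ≤ 1) {H : Subgroup G} (hH : (H : Set G) = stab η A) :
    (H.index : ℝ) ≤ ((4 * k + 2) / η) ^ (2 * k) := by
  classical
  have := Fintype.ofFinite (G ⧸ H)
  have hinj : Function.Injective (Quotient.out : G ⧸ H → G) := Quotient.out_injective
  have := hA.card_le_of_separated (Finset.univ.image (Quotient.out : G ⧸ H → G)) hη hη1 ?_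
  · rwa [Finset.card_image_of_injective _ hinj, Finset.card_univ, ← Nat.card_eq_fintype_card] at this
  · simp only [Finset.mem_image, Finset.mem_univ, true_and]
    rintro _ ⟨q, rfl⟩ _ ⟨q', rfl⟩ hne
    rw [ncard_separators]
    refine le_of_not_ge fun hle => hne ?_
    rw [← mem_stab, ← hH, SetLike.mem_coe, ← QuotientGroup.eq] at hle
    simpa using hle

end Packing

/-! ### Invariant approximation and generic test points -/

section Approximation

variable {G : Type*} [Group G]

theorem isUnionOfLeftCosets_of_mul_mem {H : Subgroup G} {D : Set G}
    (h : ∀ c ∈ D, ∀ x ∈ H, c * x ∈ D) : IsUnionOfLeftCosets H D := by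
  refine ⟨D, ?_⟩
  ext c
  simp only [Set.mem_iUnion, exists_prop]
  constructor
  · exact fun hc => ⟨c, hc, 1, H.one_mem, by simp⟩
  · rintro ⟨g, hg, x, hx, rfl⟩
    exact h g hg x hx

open scoped Classical in
/-- A set almost invariant under right translation by a subgroup is close to a set that is
exactly invariant. -/
theorem exists_invariant_approx [Finite G] (A : Set G) (H : Subgroup G) {t : ℝ}
    (h : ∀ x ∈ H, ((movedSet A x).ncard : ℝ) ≤ t) :
    ∃ D : Set G, (∀ c, ∀ x ∈ H, (c * x ∈ D ↔ c ∈ D)) ∧ ((symmDiff A D).ncard : ℝ) ≤ 2 * t := by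
  have := Fintype.ofFinite G
  have := Fintype.ofFinite H
  let f : G → ℕ := fun c => (Finset.univ.filter fun x : H => c * x ∈ A).card
  -- Majority vote on each left coset. A point where `A` and the vote disagree is moved by at least
  -- half of `H`, so double counting bounds the number of such points.
  refine ⟨{c | Fintype.card H < 2 * f c}, fun c x hx => ?_, ?_⟩
  · have : f (c * x) = f c := by
      refine Finset.card_bij (fun y _ => ⟨x, hx⟩ * y) ?_ ?_ ?_
      · intro y hy
        simpa [mul_assoc] using hy
      · intro y _ y' _ h
        exact mul_left_cancel h
      · intro y hy
        refine ⟨⟨x, hx⟩⁻¹ * y, ?_, by simp⟩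
        simpa [mul_assoc] using hy
    simp [this]
  · set D : Set G := {c | Fintype.card H < 2 * f c} with hD
    let e : G → ℕ := fun c => (Finset.univ.filter fun x : H => ¬ (c * x ∈ A ↔ c ∈ A)).card
    have he : ∀ c ∈ symmDiff A D, Fintype.card H ≤ 2 * e c := by
      intro c hc
      have hsum := Finset.card_filter_add_card_filter_not (s := (Finset.univ : Finset H))
        (fun x => c * x ∈ A)
      rw [Finset.card_univ] at hsum
      rcases hc with ⟨hcA, hcD⟩ | ⟨hcD, hcA⟩
      · have : e c = (Finset.univ.filter fun x : H => ¬ c * x ∈ A).card := by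
          simp [e, hcA]
        have hcD' : ¬ Fintype.card H < 2 * f c := hcD
        simp only [f] at hcD'
        omega
      · have : e c = f c := by simp [e, f, hcA]
        have hcD' : Fintype.card H < 2 * f c := hcD
        omega
    have hdouble : ∑ c : G, e c =
        ∑ x : H, (Finset.univ.filter fun c : G => ¬ (c * x ∈ A ↔ c ∈ A)).card := by
      simp only [e, Finset.card_filter]
      exact Finset.sum_comm
    have hup : (∑ c : G, e c : ℝ) ≤ Fintype.card H * t := by
      rw [← Nat.cast_sum, hdouble, Nat.cast_sum, ← nsmul_eq_mul, ← Finset.card_univ]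
      refine Finset.sum_le_card_nsmul _ _ _ fun x _ => ?_
      refine (le_of_eq ?_).trans (h x x.2)
      rw [← Set.ncard_coe_finset]
      congr 2
      ext c
      simp [movedSet]
    have hlow : (Fintype.card H : ℝ) * (symmDiff A D).ncard ≤ 2 * ∑ c : G, (e c : ℝ) := by
      rw [Set.ncard_eq_toFinset_card', Finset.mul_sum, mul_comm, ← nsmul_eq_mul]
      calc _ ≤ ∑ c ∈ (symmDiff A D).toFinset, 2 * (e c : ℝ) :=
            Finset.card_nsmul_le_sum _ _ _ fun c hc => by
              exact_mod_cast he c (Set.mem_toFinset.1 hc)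
        _ ≤ _ := Finset.sum_le_sum_of_subset_of_nonneg (Finset.subset_univ _)
            fun c _ _ => by positivity
    have hH : (0 : ℝ) < Fintype.card H := by exact_mod_cast Fintype.card_pos
    refine le_of_mul_le_mul_left ?_ hH
    linarith

/-- A sequence in `P` chosen generically with respect to witnesses for the coincidences among
the translates of a small set `E`. -/
theorem exists_generic_sequence [Finite G] (E P : Set G) (Z : Bool → Set G) (m : ℕ)
    (h : 2 * 2 ^ m * E.ncard < P.ncard) :
    ∃ (a : ℕ → G) (w : Bool → Finset ℕ → G), (∀ i < m, a i ∈ P) ∧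
      ∀ t, ∀ S ⊆ Finset.range m, (∃ z ∈ Z t, ∀ i ∈ S, a i * z ∈ E) →
        w t S ∈ Z t ∧ (∀ i ∈ S, a i * w t S ∈ E) ∧
          ∀ i < m, (∀ j ∈ S, j < i) → a i * w t S ∉ E := by
  classical
  have := Fintype.ofFinite G
  induction m with
  | zero =>
    have hw : ∀ t, ∃ w : G, ∀ z ∈ Z t, w ∈ Z t := fun t => by
      by_cases hz : ∃ z, z ∈ Z t
      · exact ⟨hz.choose, fun _ _ => hz.choose_spec⟩
      · exact ⟨1, fun z hz' => absurd ⟨z, hz'⟩ hz⟩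
    choose w hw using hw
    refine ⟨fun _ => 1, fun t _ => w t, by simp, fun t S hS ⟨z, hz, _⟩ => ⟨hw t z hz, ?_, by simp⟩⟩
    obtain rfl : S = ∅ := by simpa using hS
    simp
  | succ m ih =>
    obtain ⟨a, w, ha, hw⟩ := ih (lt_of_le_of_lt (by gcongr <;> omega) h)
    -- Each of the `2 * 2 ^ m` existing witnesses excludes `E.ncard` candidates, so some `b` in `P`
    -- avoids them all.
    obtain ⟨b, hbP, hb⟩ : ∃ b ∈ P, b ∉ (↑(((Finset.univ : Finset Bool) ×ˢ
        (Finset.range m).powerset).biUnion fun p =>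
          Finset.univ.filter fun c : G => c * w p.1 p.2 ∈ E) : Set G) := by
      refine Set.exists_mem_notMem_of_ncard_lt_ncard ?_
      rw [Set.ncard_coe_finset]
      refine lt_of_le_of_lt ?_ h
      refine (Finset.card_biUnion_le_card_mul _ _ E.ncard fun p _ => ?_).trans ?_
      · rw [← ncard_mul_right_preimage E (w p.1 p.2), ← Set.ncard_coe_finset]
        simp
      · rw [Finset.card_product, Finset.card_powerset, Finset.card_range, Finset.card_univ,
          Fintype.card_bool]
        gcongr <;> omega
    have hb' : ∀ t, ∀ S ⊆ Finset.range m, b * w t S ∉ E := by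
      intro t S hS hE
      refine hb ?_
      simp only [Finset.coe_biUnion, Set.mem_iUnion]
      exact ⟨(t, S), Finset.mem_product.2 ⟨Finset.mem_univ t, Finset.mem_powerset.2 hS⟩,
        by simpa using hE⟩
    let a' : ℕ → G := Function.update a m b
    have ha'm : a' m = b := Function.update_self ..
    have ha' : ∀ i < m, a' i = a i := fun i hi => Function.update_of_ne hi.ne ..
    -- Old witnesses are kept. A set containing `m` receives its witness only now; no later index
    -- exists yet, so its avoidance clause is vacuous.
    have hchoice : ∀ t, ∀ S : Finset ℕ, ∃ v : G, (S ⊆ Finset.range m → v = w t S) ∧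
        (¬ S ⊆ Finset.range m → (∃ z ∈ Z t, ∀ i ∈ S, a' i * z ∈ E) →
          v ∈ Z t ∧ ∀ i ∈ S, a' i * v ∈ E) := by
      intro t S
      by_cases hS : S ⊆ Finset.range m
      · exact ⟨w t S, fun _ => rfl, fun h => absurd hS h⟩
      · by_cases hz : ∃ z ∈ Z t, ∀ i ∈ S, a' i * z ∈ E
        · exact ⟨hz.choose, fun h => absurd h hS, fun _ _ => hz.choose_spec⟩
        · exact ⟨1, fun h => absurd h hS, fun _ h => absurd h hz⟩
    choose w' hw₁ hw₂ using hchoice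
    refine ⟨a', w', fun i hi => ?_, fun t S hS hz => ?_⟩
    · rcases Nat.lt_succ_iff_lt_or_eq.1 hi with hi | rfl
      · rw [ha' i hi]
        exact ha i hi
      · rwa [ha'm]
    · by_cases hSm : S ⊆ Finset.range m
      · have hlt : ∀ i ∈ S, i < m := fun i hi => Finset.mem_range.1 (hSm hi)
        rw [hw₁ t S hSm]
        obtain ⟨h₁, h₂, h₃⟩ := hw t S hSm (by
          obtain ⟨z, hz, hzE⟩ := hz
          exact ⟨z, hz, fun i hi => by simpa [ha' i (hlt i hi)] using hzE i hi⟩)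
        refine ⟨h₁, fun i hi => by simpa [ha' i (hlt i hi)] using h₂ i hi, fun i hi hSi => ?_⟩
        rcases Nat.lt_succ_iff_lt_or_eq.1 hi with hi | rfl
        · rw [ha' i hi]
          exact h₃ i hi hSi
        · rw [ha'm]
          exact hb' t S hSm
      · obtain ⟨h₁, h₂⟩ := hw₂ t S hSm hz
        refine ⟨h₁, h₂, fun i hi hSi => absurd (fun j hj => ?_) hSm⟩
        exact Finset.mem_range.2 ((hSi j hj).trans_le (Nat.lt_succ_iff.1 hi))

/-- A joint coincidence along a generic sequence produces a ladder in a stable set. -/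
theorem IsKStable.not_forall_mem_symmDiff {k m : ℕ} {A D Z : Set G} (hA : IsKStable k A)
    {a : ℕ → G} {w : Finset ℕ → G} {s : Prop} (hs : ∀ i < m, ∀ z ∈ Z, (a i * z ∈ D ↔ s))
    (hw : ∀ S ⊆ Finset.range m, (∃ z ∈ Z, ∀ i ∈ S, a i * z ∈ symmDiff A D) →
        w S ∈ Z ∧ (∀ i ∈ S, a i * w S ∈ symmDiff A D) ∧
          ∀ i < m, (∀ j ∈ S, j < i) → a i * w S ∉ symmDiff A D)
    {S : Finset ℕ} (hS : S ⊆ Finset.range m) (hk : S.card = k) {z : G} (hz : z ∈ Z) :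
    ¬ ∀ i ∈ S, a i * z ∈ symmDiff A D := by
  intro hzS
  let e := S.orderEmbOfFin hk
  have heS : ∀ r, e r ∈ S := S.orderEmbOfFin_mem hk
  -- `T j` holds the first `j` elements of `S`. Its witness lands in the error set exactly at those
  -- indices among `S`: there by choice, and not later by genericity.
  let T : ℕ → Finset ℕ := fun j => (Finset.univ.filter fun r : Fin k => (r : ℕ) < j).image e
  have hT : ∀ j, T j ⊆ S := by
    intro j i hi
    obtain ⟨r, -, rfl⟩ := Finset.mem_image.1 hi
    exact heS r
  have hwT := fun j => hw (T j) ((hT j).trans hS) ⟨z, hz, fun i hi => hzS i (hT j hi)⟩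
  have hlt : ∀ r, e r < m := fun r => Finset.mem_range.1 (hS (heS r))
  have hE : ∀ (r : Fin k) (j : ℕ), a (e r) * w (T j) ∈ symmDiff A D ↔ (r : ℕ) < j := by
    intro r j
    constructor
    · intro hmem
      by_contra! hjr
      refine (hwT j).2.2 (e r) (hlt r) (fun i hi => ?_) hmem
      obtain ⟨r', hr', rfl⟩ := Finset.mem_image.1 hi
      refine e.strictMono (Fin.lt_def.2 ?_)
      have := (Finset.mem_filter.1 hr').2
      omega
    · exact fun hr => (hwT j).2.1 _ (Finset.mem_image_of_mem _ (by simpa using hr))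
  have hD := fun (r : Fin k) (j : ℕ) => hs (e r) (hlt r) (w (T j)) (hwT j).1
  simp only [Set.mem_symmDiff] at hE
  -- Membership in `D` is constant along the sequence, so the half-graph for the error set is one
  -- for `A`, or for its complement when `s` holds; reversing both orders handles the latter.
  by_cases h : s
  · refine hA ⟨fun i => a (e i.rev), fun j => w (T j.rev), fun i j => ?_⟩
    have h₁ := hE i.rev j.rev
    have h₂ := hD i.rev j.rev
    rw [← Fin.rev_le_rev, Fin.le_def, ← not_lt]
    tauto
  · refine hA ⟨fun i => a (e i), fun j => w (T (j + 1)), fun i j => ?_⟩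
    have h₁ := hE i (j + 1)
    have h₂ := hD i (j + 1)
    rw [Nat.lt_succ_iff] at h₁
    rw [Fin.le_def]
    tauto

end Approximation

/-! ### Separating the subgroup and Boolean combinations -/

section Separation

variable {G : Type*} [Group G]

/-- On a large set of `a`, the set `D` has one constant value at `a` and the opposite one at `a *
y`, hence on `a * H` and `a * y * H`. Among `2k` generic such `a`, each of `x` and `z` meets fewer
than `k` errors, so at some `a i` neither does and `A` separates them as `D` does. -/
theorem IsKStable.exists_separating_coset [Finite G] {k : ℕ} {A D : Set G} (hA : IsKStable k A)
    {H : Subgroup G} (hD : ∀ c, ∀ x ∈ H, (c * x ∈ D ↔ c ∈ D)) {y : G}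
    (hy : 6 * 2 ^ (2 * k) * (symmDiff A D).ncard < (movedSet A y).ncard) :
    ∃ a : ℕ → G, ∀ x ∈ H, ∀ z, y⁻¹ * z ∈ H → ∃ i < 2 * k, ¬ (a i * x ∈ A ↔ a i * z ∈ A) := by
  set E := symmDiff A D with hE
  -- A point moved by `y` either sees `D` change, in one of two directions, or has an error at `a`
  -- or at `a * y`. The constant 6 covers two sets of size `2 * 2 ^ (2 * k) * |E|` and two copies of
  -- `E`.
  obtain ⟨s, P, hP, hPs⟩ : ∃ (s : Prop) (P : Set G), 2 * 2 ^ (2 * k) * E.ncard < P.ncard ∧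
      ∀ a ∈ P, (a ∈ D ↔ s) ∧ (a * y ∈ D ↔ ¬ s) := by
    by_contra! hno
    have h₁ : {a | a ∈ D ∧ a * y ∉ D}.ncard ≤ 2 * 2 ^ (2 * k) * E.ncard := by
      by_contra! hlt
      obtain ⟨a, ⟨ha, ha'⟩, hne⟩ := hno True _ hlt
      have := hne (by simpa using ha)
      tauto
    have h₂ : {a | a ∉ D ∧ a * y ∈ D}.ncard ≤ 2 * 2 ^ (2 * k) * E.ncard := by
      by_contra! hlt
      obtain ⟨a, ⟨ha, ha'⟩, hne⟩ := hno False _ hlt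
      have := hne (by simpa using ha)
      tauto
    have hsub : movedSet A y ⊆ ({a | a ∈ D ∧ a * y ∉ D} ∪ {a | a ∉ D ∧ a * y ∈ D}) ∪
        (E ∪ {a | a * y ∈ E}) := by
      intro a ha
      simp only [movedSet, hE, Set.mem_union, Set.mem_ofPred_eq, Set.mem_symmDiff] at ha ⊢
      tauto
    have h₃ := Set.ncard_le_ncard hsub (Set.toFinite _)
    have h₄ := Set.ncard_union_le ({a | a ∈ D ∧ a * y ∉ D} ∪ {a | a ∉ D ∧ a * y ∈ D})
        (E ∪ {a | a * y ∈ E})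
    have h₅ := Set.ncard_union_le {a | a ∈ D ∧ a * y ∉ D} {a | a ∉ D ∧ a * y ∈ D}
    have h₆ := Set.ncard_union_le E {a | a * y ∈ E}
    rw [ncard_mul_right_preimage] at h₆
    have h₇ : 1 * E.ncard ≤ 2 ^ (2 * k) * E.ncard := Nat.mul_le_mul_right _ Nat.one_le_two_pow
    simp only [mul_assoc] at hy h₁ h₂
    omega
  let Z : Bool → Set G := fun t => {z | (if t then y else 1)⁻¹ * z ∈ H}
  obtain ⟨a, w, haP, hw⟩ := exists_generic_sequence E P Z (2 * k) hP
  have hZ : ∀ t, ∀ i < 2 * k, ∀ z ∈ Z t,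
      (a i * z ∈ D ↔ if t then ¬ s else s) := by
    intro t i hi z hz
    have hai := hPs _ (haP i hi)
    cases t
    · have hz' : z ∈ H := by simpa [Z] using hz
      rw [hD _ z hz']
      simpa using hai.1
    · have hz' : y⁻¹ * z ∈ H := by simpa [Z] using hz
      have := hD (a i * y) _ hz'
      rw [mul_assoc, mul_inv_cancel_left] at this
      rw [this]
      simpa using hai.2
  have hfew : ∀ t, ∀ z ∈ Z t, {i ∈ (Finset.range (2 * k) : Set ℕ) | a i * z ∈ E}.ncard < k := by
    classical
    intro t z hz
    by_contra! hcard
    have hcoe : {i ∈ (Finset.range (2 * k) : Set ℕ) | a i * z ∈ E} =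
        ((Finset.range (2 * k)).filter fun i => a i * z ∈ E : Finset ℕ) := by
      ext; simp
    rw [hcoe, Set.ncard_coe_finset] at hcard
    obtain ⟨S, hS, hSk⟩ := Finset.exists_subset_card_eq hcard
    exact hA.not_forall_mem_symmDiff (hZ t) (hw t)
      (fun i hi => (Finset.mem_filter.1 (hS hi)).1) hSk hz
      fun i hi => (Finset.mem_filter.1 (hS hi)).2
  refine ⟨a, fun x hx z hz => ?_⟩
  have hxZ : x ∈ Z false := by simpa [Z] using hx
  have hzZ : z ∈ Z true := by simpa [Z] using hz
  have hx' := hfew false x hxZ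
  have hz' := hfew true z hzZ
  obtain ⟨i, hi, hiE⟩ : ∃ i ∈ (Finset.range (2 * k) : Set ℕ),
      i ∉ {i ∈ (Finset.range (2 * k) : Set ℕ) | a i * x ∈ E} ∪
        {i ∈ (Finset.range (2 * k) : Set ℕ) | a i * z ∈ E} := by
    refine Set.exists_mem_notMem_of_ncard_lt_ncard ?_ ?_
    · rw [Set.ncard_coe_finset, Finset.card_range]
      refine (Set.ncard_union_le _ _).trans_lt ?_
      omega
    · exact ((Finset.range (2 * k)).finite_toSet.subset fun i hi => hi.1).union
        ((Finset.range (2 * k)).finite_toSet.subset fun i hi => hi.1)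
  have hi' : i < 2 * k := by simpa using hi
  refine ⟨i, hi', ?_⟩
  have h₁ := hZ false i hi' x hxZ
  have h₂ := hZ true i hi' z hzZ
  have h₃ : a i * x ∉ E := fun h => hiE (Or.inl ⟨hi, h⟩)
  have h₄ : a i * z ∉ E := fun h => hiE (Or.inr ⟨hi, h⟩)
  simp only [hE, Set.mem_symmDiff] at h₃ h₄
  simp only [Bool.false_eq_true, if_false, if_true] at h₁ h₂
  tauto

theorem IsKStable.exists_separating [Finite G] {k : ℕ} {A D : Set G} (hA : IsKStable k A)
    {H : Subgroup G} (hD : ∀ c, ∀ x ∈ H, (c * x ∈ D ↔ c ∈ D))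
    (hH : ∀ y ∉ H, 6 * 2 ^ (2 * k) * (symmDiff A D).ncard < (movedSet A y).ncard) :
    ∃ F : Finset G, F.card ≤ H.index * (2 * k) ∧
      ∀ x ∈ H, ∀ z ∉ H, ∃ a ∈ F, ¬ (a * x ∈ A ↔ a * z ∈ A) := by
  classical
  have := Fintype.ofFinite (G ⧸ H)
  have hex : ∀ q : G ⧸ H, ∃ a : ℕ → G, q ≠ ((1 : G) : G ⧸ H) → ∀ x ∈ H, ∀ z : G,
      (z : G ⧸ H) = q → ∃ i < 2 * k, ¬ (a i * x ∈ A ↔ a i * z ∈ A) := by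
    intro q
    induction q using QuotientGroup.induction_on with
    | H y =>
      by_cases hy : y ∈ H
      · exact ⟨fun _ => 1, fun hne => absurd (QuotientGroup.eq.2 (by simpa using hy)) hne⟩
      · obtain ⟨a, ha⟩ := hA.exists_separating_coset hD (hH y hy)
        exact ⟨a, fun _ x hx z hz => ha x hx z (QuotientGroup.eq.1 hz.symm)⟩
  choose a ha using hex
  refine ⟨Finset.univ.biUnion fun q => (Finset.range (2 * k)).image (a q), ?_, ?_⟩
  · refine (Finset.card_biUnion_le_card_mul _ _ (2 * k) fun q _ => ?_).trans_eq ?_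
    · exact Finset.card_image_le.trans_eq (Finset.card_range _)
    · rw [Finset.card_univ, ← Nat.card_eq_fintype_card, Subgroup.index]
  · intro x hx z hz
    obtain ⟨i, hi, h⟩ := ha z (fun h => hz (by simpa using QuotientGroup.eq.1 h)) x hx z rfl
    exact ⟨a z i, Finset.mem_biUnion.2 ⟨z, Finset.mem_univ _,
      Finset.mem_image_of_mem _ (Finset.mem_range.2 hi)⟩, h⟩

/-- Separation makes `H` a union of classes of points with the same trace on `F`. The terms of the
union are the traces realized in `H`, whose number Sauer–Shelah bounds; repeating an element of `F`
pads the list of translates to length `n`. -/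
theorem IsKStable.exists_isTranslateCombination [Finite G] {k : ℕ} {A : Set G}
    (hA : IsKStable k A) {H : Set G} {F : Finset G} (hF : F.Nonempty)
    (hsep : ∀ x ∈ H, ∀ z ∉ H, ∃ a ∈ F, ¬ (a * x ∈ A ↔ a * z ∈ A)) {n : ℕ} (hn : F.card ≤ n) :
    ∃ l ≤ (F.card + 1) ^ k, IsTranslateCombination n l A H := by
  classical
  have := Fintype.ofFinite G
  set 𝒬 := H.toFinset.image fun y => F.filter fun a => a * y ∈ A with h𝒬
  obtain ⟨f, hfF, hf⟩ : ∃ f : Fin n → G, (∀ i, f i ∈ F) ∧ ∀ a ∈ F, ∃ i, f i = a := by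
    obtain ⟨a₀, ha₀⟩ := hF
    refine ⟨fun i => if h : (i : ℕ) < F.card then F.equivFin.symm ⟨i, h⟩ else a₀, fun i => ?_,
      fun a ha => ?_⟩
    · dsimp only
      split_ifs
      · exact Subtype.coe_prop _
      · exact ha₀
    · refine ⟨⟨F.equivFin ⟨a, ha⟩, (F.equivFin ⟨a, ha⟩).isLt.trans_le hn⟩, ?_⟩
      simp
  refine ⟨𝒬.card, hA.card_image_filter_le F _, fun i => (f i)⁻¹,
    fun t i => if f i ∈ (𝒬.equivFin.symm t : Finset G) then (f i)⁻¹ • A else ((f i)⁻¹ • A)ᶜ,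
    fun t i => ?_, ?_⟩
  · dsimp only
    split_ifs <;> simp
  · have hX : ∀ t x, (x ∈ ⋂ i, (if f i ∈ (𝒬.equivFin.symm t : Finset G) then (f i)⁻¹ • A
        else ((f i)⁻¹ • A)ᶜ)) ↔
        ∀ i, (f i * x ∈ A ↔ f i ∈ (𝒬.equivFin.symm t : Finset G)) := by
      intro t x
      rw [Set.mem_iInter]
      refine forall_congr' fun i => ?_
      split_ifs with h <;> simp [Set.mem_inv_smul_set_iff, h]
    ext x
    simp only [Set.mem_iUnion, hX]
    constructor
    · intro hx
      have hmem : (F.filter fun a => a * x ∈ A) ∈ 𝒬 :=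
        Finset.mem_image_of_mem _ (Set.mem_toFinset.2 hx)
      refine ⟨𝒬.equivFin ⟨_, hmem⟩, fun i => ?_⟩
      simp [hfF]
    · rintro ⟨t, ht⟩
      obtain ⟨y, hy, hyt⟩ := Finset.mem_image.1 (𝒬.equivFin.symm t).2
      rw [Set.mem_toFinset] at hy
      by_contra hx
      obtain ⟨a, ha, hne⟩ := hsep y hy x hx
      obtain ⟨i, rfl⟩ := hf a ha
      have := ht i
      rw [← hyt, Finset.mem_filter] at this
      tauto

end Separation

/-! ### The subgroup at a scale governed by a growth function -/

/-- For a stable set and a growth function `g`, one of boundedly many scales `Y` in the orbit of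
`y₀` under `g` yields a subgroup `stab Y⁻¹ A` that approximates `A` with error governed by `g Y`. -/
theorem IsKStable.exists_subgroup_of_growth (k : ℕ) : ∃ L n : ℕ, 1 ≤ L ∧
    ∀ {G : Type*} [Group G] [Finite G] {A : Set G}, IsKStable k A →
      ∀ g : ℝ → ℝ, (∀ y, 1 ≤ y → L * y ^ L ≤ g y) → ∀ y₀, 1 ≤ y₀ →
        ∃ i < n, y₀ ≤ g^[i] y₀ ∧ ∃ (H : Subgroup G) (D : Set G) (F : Finset G),
          (H : Set G) = stab (1 / g^[i] y₀) A ∧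
          (H.index : ℝ) ≤ L * (g^[i] y₀) ^ L ∧
          (∀ c, ∀ x ∈ H, (c * x ∈ D ↔ c ∈ D)) ∧
          ((symmDiff A D).ncard : ℝ) ≤ 2 * (1 / g (g^[i] y₀) * Nat.card G) ∧
          F.Nonempty ∧ (F.card : ℝ) ≤ L * (g^[i] y₀) ^ L ∧
          ∀ x ∈ H, ∀ z ∉ H, ∃ a ∈ F, ¬ (a * x ∈ A ↔ a * z ∈ A) := by
  classical
  obtain ⟨n, hn⟩ := IsKStable.exists_stab_eq k
  set B : ℕ := (4 * k + 2) ^ (2 * k) with hB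
  -- The summands serve, in turn, the separation constant, the bounds on the index and on `F`, the
  -- exponent `2 * k`, and the ratio 4 between thresholds.
  set L : ℕ := 12 * 2 ^ (2 * k) + B * (2 * k + 1) + 2 * k + 4 with hL
  have hL1 : 1 ≤ L := by omega
  refine ⟨L, n, hL1, fun {G _ _ A} hA g hg y₀ hy₀ => ?_⟩
  have hstep : ∀ y, 1 ≤ y → L * y ≤ g y := fun y hy => le_trans (by
    gcongr
    exact le_self_pow₀ hy (by omega)) (hg y hy)
  have hL4 : (4 : ℝ) ≤ L := by exact_mod_cast (by omega : 4 ≤ L)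
  have hY₀ : ∀ j, y₀ ≤ g^[j] y₀ := by
    intro j
    induction j with
    | zero => exact le_rfl
    | succ j ih =>
      rw [Function.iterate_succ_apply']
      have := hstep _ (hy₀.trans ih)
      nlinarith
  have hY : ∀ j, 1 ≤ g^[j] y₀ := fun j => hy₀.trans (hY₀ j)
  obtain ⟨i, hi, hstab⟩ := hn hA (fun j => 1 / g^[j] y₀)
    (fun j => by have := hY j; positivity) (fun j => by
      have h₁ := hY j
      have h₂ := hstep _ h₁
      rw [Function.iterate_succ_apply', mul_one_div, div_le_div_iff₀ (by nlinarith) (by linarith)]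
      nlinarith)
  set Y := g^[i] y₀ with hYdef
  have hY1 : 1 ≤ Y := hY i
  have hgY := hstep Y hY1
  have hgpos : 0 < g Y := by nlinarith
  rw [Function.iterate_succ_apply', ← hYdef] at hstab
  obtain ⟨H, hH⟩ := exists_subgroup_eq_stab (A := A) (η := 1 / Y) (η' := 1 / g Y)
    (by positivity) (by
      rw [mul_one_div, div_le_div_iff₀ hgpos (by linarith)]
      nlinarith) hstab
  -- The coincidence of scales is used here: elements of `H` satisfy the much stronger displacement
  -- bound `1 / g Y`.
  obtain ⟨D, hD, hAD⟩ := exists_invariant_approx A H (t := 1 / g Y * Nat.card G) fun x hx => by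
    rw [← mem_stab, ← hstab, ← hH]
    exact hx
  have hG : (0 : ℝ) < Nat.card G := by exact_mod_cast Nat.card_pos
  have hsep : ∀ y ∉ H, 6 * 2 ^ (2 * k) * (symmDiff A D).ncard < (movedSet A y).ncard := by
    intro y hy
    rw [← SetLike.mem_coe, hH, mem_stab, not_le] at hy
    have h₁ : (12 * 2 ^ (2 * k) : ℝ) ≤ L := by
      exact_mod_cast (by omega : 12 * 2 ^ (2 * k) ≤ L)
    have h₂ : (6 * 2 ^ (2 * k) * (symmDiff A D).ncard : ℝ) < (movedSet A y).ncard := by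
      calc (6 * 2 ^ (2 * k) * (symmDiff A D).ncard : ℝ)
          ≤ 6 * 2 ^ (2 * k) * (2 * (1 / g Y * Nat.card G)) := by gcongr
        _ = 12 * 2 ^ (2 * k) / g Y * Nat.card G := by ring
        _ ≤ L / (L * Y) * Nat.card G := by gcongr
        _ = 1 / Y * Nat.card G := by field_simp
        _ < _ := hy
    exact_mod_cast h₂
  obtain ⟨F, hF, hFsep⟩ := hA.exists_separating hD hsep
  have hidx : (H.index : ℝ) ≤ B * Y ^ (2 * k) := by
    refine (hA.index_le (by positivity) (by rw [div_le_one (by linarith)]; exact hY1) hH).trans ?_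
    rw [hB, div_div_eq_mul_div, div_one, mul_pow]
    push_cast
    rfl
  have hpow : Y ^ (2 * k) ≤ Y ^ L := pow_le_pow_right₀ hY1 (by omega)
  -- The element 1 is inserted only to make the separating set nonempty.
  refine ⟨i, hi, hY₀ i, H, D, insert 1 F, hH, ?_, hD, hAD, Finset.insert_nonempty _ _, ?_, ?_⟩
  · refine hidx.trans ?_
    have : B ≤ L := by
      have : B * 1 ≤ B * (2 * k + 1) := Nat.mul_le_mul_left _ (by omega)
      omega
    gcongr
  · have h₁ : ((insert 1 F).card : ℝ) ≤ H.index * (2 * k) + 1 := by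
      exact_mod_cast (Finset.card_insert_le _ _).trans (Nat.succ_le_succ hF)
    have h₂ : (B * (2 * k) + 1 : ℝ) ≤ L := by
      have : B * (2 * k + 1) = B * (2 * k) + B := by ring
      exact_mod_cast (by omega : B * (2 * k) + 1 ≤ L)
    calc _ ≤ _ := h₁
      _ ≤ B * Y ^ (2 * k) * (2 * k) + 1 * Y ^ (2 * k) := by
        gcongr
        rw [one_mul]
        exact one_le_pow₀ hY1
      _ = (B * (2 * k) + 1) * Y ^ (2 * k) := by ring
      _ ≤ _ := by gcongr
  · intro x hx z hz
    obtain ⟨a, ha, h⟩ := hFsep x hx z hz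
    exact ⟨a, Finset.mem_insert_of_mem ha, h⟩

theorem le_choose_of_pos_of_lt {n j : ℕ} (hj : 0 < j) (hjn : j < n) : n ≤ n.choose j := by
  induction n generalizing j with
  | zero => omega
  | succ n ih =>
    obtain ⟨j, rfl⟩ := Nat.exists_eq_succ_of_ne_zero hj.ne'
    rw [Nat.succ_eq_add_one, Nat.choose_succ_succ]
    have h₁ : 0 < n.choose j := Nat.choose_pos (by omega)
    rcases Nat.lt_succ_iff_lt_or_eq.1 hjn with h | h
    · have := ih hj h
      simp only [Nat.succ_eq_add_one] at this ⊢
      omega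
    · subst h
      simp

/-- Padding makes `n` exceed both `(|F| + 1) ^ k` and `1 / ε`. Then `0 < ⌊ε * n⌋₊ < n`, and the
binomial coefficient is at least `n`. -/
theorem IsKStable.exists_combination_le_choose {G : Type*} [Group G] [Finite G] {k : ℕ}
    {A : Set G} (hA : IsKStable k A) {H : Set G} {F : Finset G} (hF : F.Nonempty)
    (hsep : ∀ x ∈ H, ∀ z ∉ H, ∃ a ∈ F, ¬ (a * x ∈ A ↔ a * z ∈ A)) {ε M : ℝ} (hε : 0 < ε)
    (hε1 : ε < 1) (hM : (F.card : ℝ) ≤ M) :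
    ∃ n l : ℕ, 1 ≤ n ∧ (n : ℝ) ≤ M + (M + 1) ^ k + 1 / ε + 2 ∧ l ≤ n.choose ⌊ε * n⌋₊ ∧
      IsTranslateCombination n l A H := by
  set n := F.card + (F.card + 1) ^ k + ⌈1 / ε⌉₊ + 1 with hn
  obtain ⟨l, hl, hc⟩ := hA.exists_isTranslateCombination hF hsep (n := n) (by omega)
  have hn0 : (0 : ℝ) < n := by exact_mod_cast (by omega : 0 < n)
  refine ⟨n, l, by omega, ?_, ?_, hc⟩
  · have h₁ : (⌈1 / ε⌉₊ : ℝ) ≤ 1 / ε + 1 := (Nat.ceil_lt_add_one (by positivity)).le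
    have h₂ : ((F.card : ℝ) + 1) ^ k ≤ (M + 1) ^ k := by gcongr
    rw [hn]
    push_cast
    linarith
  · refine (hl.trans (by omega : (F.card + 1) ^ k ≤ n)).trans (le_choose_of_pos_of_lt ?_ ?_)
    · rw [Nat.floor_pos]
      have h₁ : 1 / ε ≤ n := (Nat.le_ceil _).trans (by exact_mod_cast (by omega : ⌈1 / ε⌉₊ ≤ n))
      rwa [div_le_iff₀ hε, mul_comm] at h₁
    · rw [Nat.floor_lt (by positivity)]
      nlinarith

theorem approximatesWithIndex_of_invariant {G : Type*} [Group G] [Finite G] {A D : Set G}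
    {H : Subgroup G} (hD : ∀ c, ∀ x ∈ H, (c * x ∈ D ↔ c ∈ D)) {δ ε N : ℝ}
    (hAD : ((symmDiff A D).ncard : ℝ) ≤ δ * Nat.card G) (hN : (H.index : ℝ) ≤ N)
    (hδ : δ * H.index < ε) : ApproximatesWithIndex ε N A H := by
  refine ⟨hN, D, isUnionOfLeftCosets_of_mul_mem fun c hc x hx => (hD c x hx).2 hc,
    hAD.trans_lt ?_⟩
  have hH : (0 : ℝ) < Nat.card H := by exact_mod_cast Nat.card_pos
  rw [← H.card_mul_index, Nat.cast_mul, mul_comm (Nat.card H : ℝ), ← mul_assoc]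
  gcongr

/-- The normal core is the kernel of the action on the cosets of `H`, so its quotient embeds in a
symmetric group. -/
theorem index_normalCore_le_factorial {G : Type*} [Group G] [Finite G] (H : Subgroup G) :
    H.normalCore.index ≤ H.index.factorial := by
  rw [Subgroup.normalCore_eq_ker, Subgroup.index_ker, Subgroup.index, ← Nat.card_perm]
  exact Nat.card_le_card_of_injective _ Subtype.val_injective

theorem coe_normalCore_eq_iInter {G : Type*} [Group G] (H : Subgroup G) :
    (H.normalCore : Set G) = ⋂ g : G, (fun h => g * h * g⁻¹) '' (H : Set G) := by
  ext x
  simp only [SetLike.mem_coe, Set.mem_iInter, Set.mem_image]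
  constructor
  · intro hx g
    exact ⟨g⁻¹ * x * g⁻¹⁻¹, hx g⁻¹, by group⟩
  · intro hx g
    obtain ⟨h, hh, rfl⟩ := hx g⁻¹
    simpa [mul_assoc] using hh

/-! ### Polynomial and iterated exponential growth -/

section Growth

theorem natCast_mul_pow_le {a m C : ℕ} (ha : a ≤ C) (hm : m ≤ C) {y : ℝ} (hy : 1 ≤ y) :
    (a : ℝ) * y ^ m ≤ C * y ^ C := by
  have h₁ : (a : ℝ) ≤ C := by exact_mod_cast ha
  exact mul_le_mul h₁ (pow_le_pow_right₀ hy hm) (by positivity) (by positivity)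

theorem natCast_mul_pow_mono {M C : ℕ} (h : M ≤ C) {y : ℝ} (hy : 1 ≤ y) :
    (M : ℝ) * y ^ M ≤ C * y ^ C :=
  natCast_mul_pow_le h h hy

theorem exists_poly_comp_le (M K : ℕ) : ∃ C : ℕ, ∀ x Y : ℝ, 1 ≤ x → 0 ≤ Y →
    Y ≤ K * x ^ K → M * Y ^ M ≤ C * x ^ C := by
  refine ⟨M * K ^ M + K * M, fun x Y hx hY hYx => ?_⟩
  calc (M : ℝ) * Y ^ M ≤ M * (K * x ^ K) ^ M := by gcongr
    _ = (M * K ^ M : ℕ) * x ^ (K * M) := by push_cast; rw [mul_pow, ← pow_mul]; ring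
    _ ≤ _ := natCast_mul_pow_le (by omega) (by omega) hx

theorem exists_poly_iterate_le (K n : ℕ) : ∃ C : ℕ, ∀ i < n, ∀ x : ℝ, 1 ≤ x →
    (fun y : ℝ => K * y ^ K)^[i] x ≤ C * x ^ C := by
  induction n with
  | zero => exact ⟨0, by simp⟩
  | succ n ih =>
    obtain ⟨C, hC⟩ := ih
    obtain ⟨C', hC'⟩ := exists_poly_comp_le K C
    refine ⟨C + C' + 1, fun i hi x hx => ?_⟩
    rcases i with _ | i
    · simpa using natCast_mul_pow_mono (show 1 ≤ C + C' + 1 by omega) hx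
    · rw [Function.iterate_succ_apply']
      refine (hC' x _ hx ?_ (hC i (by omega) x hx)).trans (natCast_mul_pow_mono (by omega) hx)
      rcases i with _ | i
      · exact zero_le_one.trans hx
      · clear hi
        induction i with
        | zero => simp; positivity
        | succ i ih => rw [Function.iterate_succ_apply']; positivity

theorem exists_poly_bound (L k : ℕ) : ∃ M : ℕ, ∀ Y : ℝ, 1 ≤ Y →
    L * Y ^ L + (L * Y ^ L + 1) ^ k + Y + 2 ≤ M * Y ^ M := by
  refine ⟨L + (L + 1) ^ k + 3 + (L + L * k + 1), fun Y hY => ?_⟩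
  set m := L + L * k + 1 with hm
  have h₁ : Y ^ L ≤ Y ^ m := pow_le_pow_right₀ hY (by omega)
  have h₂ : (L * Y ^ L + 1) ^ k ≤ (L + 1) ^ k * Y ^ m := by
    calc (L * Y ^ L + 1) ^ k ≤ (L * Y ^ L + 1 * Y ^ L) ^ k := by
          gcongr
          rw [one_mul]
          exact one_le_pow₀ hY
      _ = (L + 1) ^ k * Y ^ (L * k) := by rw [← add_mul, mul_pow, ← pow_mul]
      _ ≤ _ := by
        gcongr
        omega
  have h₃ : Y ≤ Y ^ m := le_self_pow₀ hY (by omega)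
  have h₄ : 1 ≤ Y ^ m := one_le_pow₀ hY
  calc _ ≤ L * Y ^ m + (L + 1) ^ k * Y ^ m + Y ^ m + 2 * Y ^ m := by
        gcongr
        linarith
    _ = (L + (L + 1) ^ k + 3 : ℕ) * Y ^ m := by push_cast; ring
    _ ≤ _ := natCast_mul_pow_le (by omega) (by omega) hY

theorem two_rpow_ge_add_one {y : ℝ} (hy : 1 ≤ y) : y + 1 ≤ (2 : ℝ) ^ y := by
  have := one_add_mul_self_le_rpow_one_add (s := 1) (by norm_num) hy
  norm_num at this
  linarith

theorem iterExp_succ (m : ℕ) (x : ℝ) : iterExp (m + 1) x = 2 ^ iterExp m x :=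
  Function.iterate_succ_apply' ..

theorem iterExp_add (m n : ℕ) (x : ℝ) : iterExp (m + n) x = iterExp m (iterExp n x) :=
  Function.iterate_add_apply ..

theorem iterate_iterExp (c i : ℕ) : (iterExp c)^[i] = iterExp (c * i) := by
  have h : ∀ m, iterExp m = (fun y : ℝ => (2 : ℝ) ^ y)^[m] := fun m => rfl
  rw [h, h, Function.iterate_mul]

theorem add_le_iterExp (m : ℕ) {x : ℝ} (hx : 1 ≤ x) : x + m ≤ iterExp m x := by
  induction m with
  | zero => simp [iterExp]
  | succ m ih =>
    rw [iterExp_succ]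
    have := two_rpow_ge_add_one (y := iterExp m x) (by
      have : (0 : ℝ) ≤ m := m.cast_nonneg
      linarith)
    push_cast
    linarith

theorem one_le_iterExp (m : ℕ) {x : ℝ} (hx : 1 ≤ x) : 1 ≤ iterExp m x := by
  have := add_le_iterExp m hx
  have : (0 : ℝ) ≤ m := m.cast_nonneg
  linarith

theorem iterExp_le_iterExp {m n : ℕ} (h : m ≤ n) {x : ℝ} (hx : 1 ≤ x) :
    iterExp m x ≤ iterExp n x := by
  obtain ⟨d, rfl⟩ := Nat.exists_eq_add_of_le' h
  rw [iterExp_add]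
  have := add_le_iterExp d (one_le_iterExp m hx)
  have : (0 : ℝ) ≤ d := d.cast_nonneg
  linarith

theorem exists_poly_le_iterExp (M : ℕ) : ∃ c : ℕ, ∀ y : ℝ, 1 ≤ y → M * y ^ M ≤ iterExp c y := by
  have hlog : 0 < Real.log 2 := Real.log_pos (by norm_num)
  have hM : (0 : ℝ) < 1 / (M + 1) := by positivity
  obtain ⟨z₀, hz₀⟩ := Filter.eventually_atTop.1
    ((isLittleO_pow_exp_pos_mul_atTop M hlog).def hM)
  -- Each exponentiation adds at least 1, so `c` of them pass the threshold `z₀`; one more beats the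
  -- polynomial.
  obtain ⟨c, hc⟩ := exists_nat_ge z₀
  refine ⟨c + 1, fun y hy => ?_⟩
  rw [iterExp_succ]
  set z := iterExp c y with hz
  have hzc := add_le_iterExp c hy
  have hc0 : (0 : ℝ) ≤ c := c.cast_nonneg
  have h := hz₀ z (by linarith)
  have hz0 : 0 ≤ z := by linarith
  rw [Real.norm_of_nonneg (by positivity), Real.norm_of_nonneg (by positivity), one_div,
    inv_mul_eq_div, le_div_iff₀ (by positivity), ← Real.rpow_def_of_pos (by norm_num)] at h
  calc M * y ^ M ≤ M * z ^ M := by gcongr; linarith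
    _ ≤ z ^ M * (M + 1) := by nlinarith [pow_nonneg hz0 M]
    _ ≤ _ := h

theorem factorial_le_two_rpow_sq {N : ℕ} {B : ℝ} (h : (N : ℝ) ≤ B) :
    (N.factorial : ℝ) ≤ 2 ^ (B ^ 2) := by
  have h₁ : N.factorial ≤ 2 ^ (N * N) := by
    rw [pow_mul]
    exact (Nat.factorial_le_pow N).trans (Nat.pow_le_pow_left Nat.lt_two_pow_self.le _)
  calc (N.factorial : ℝ) ≤ 2 ^ (N * N) := by exact_mod_cast h₁
    _ = 2 ^ ((N : ℝ) ^ 2) := by rw [← Real.rpow_natCast]; push_cast; rw [sq]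
    _ ≤ _ := by
      gcongr
      norm_num

theorem exists_factorial_lt_iterExp (L : ℕ) : ∃ c : ℕ, ∀ y : ℝ, 1 ≤ y →
    L * y ^ L ≤ iterExp c y ∧ ∀ N : ℕ, (N : ℝ) ≤ L * y ^ L →
      2 * N.factorial * y < iterExp c y := by
  -- The exponent 2 comes from `N! ≤ 2 ^ (N ^ 2)`: the square has to be dominated in the exponent.
  obtain ⟨M, hM⟩ := exists_poly_bound L 2
  obtain ⟨c, hc⟩ := exists_poly_le_iterExp M
  refine ⟨c + 1, fun y hy => ?_⟩
  have h := (hM y hy).trans (hc y hy)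
  have hL : (0 : ℝ) ≤ L * y ^ L := by positivity
  rw [iterExp_succ]
  constructor
  · have := two_rpow_ge_add_one (one_le_iterExp c hy)
    nlinarith
  · intro N hN
    calc 2 * (N.factorial : ℝ) * y ≤ 2 ^ (1 : ℝ) * 2 ^ ((L * y ^ L) ^ 2) * 2 ^ y := by
          gcongr
          · norm_num
          · exact factorial_le_two_rpow_sq hN
          · linarith [two_rpow_ge_add_one hy]
      _ = 2 ^ (1 + (L * y ^ L) ^ 2 + y) := by
          rw [Real.rpow_add (by norm_num), Real.rpow_add (by norm_num)]
      _ < 2 ^ iterExp c y := by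
          apply Real.rpow_lt_rpow_of_exponent_lt (by norm_num)
          nlinarith

end Growth

/-! ### The main theorem -/

theorem theorem1p4 (k : ℕ) :
    ∃ C : ℕ, 0 < C ∧
      ∀ (G : Type*) [Group G] [Finite G] (A : Set G), IsKStable k A →
        ∀ ε : ℝ, 0 < ε → ε < 1 →
          -- part (a)
          (∃ (H : Subgroup G) (η : ℝ),
            ApproximatesWithIndex ε (C * (1 / ε) ^ C) A H ∧
            ε ^ C / C ≤ η ∧ η ≤ ε ∧
            (H : Set G) = stab η A ∧
            ∃ n l : ℕ, 1 ≤ n ∧ (n : ℝ) ≤ C * (1 / ε) ^ C ∧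
              l ≤ n.choose ⌊ε * n⌋₊ ∧
              IsTranslateCombination n l A (H : Set G)) ∧
          -- part (b)
          (∃ H : Subgroup G, H.Normal ∧
            ApproximatesWithIndex ε (iterExp C (1 / ε)) A H ∧
            ∃ (H₀ : Subgroup G) (η : ℝ),
              (H : Set G) = ⋂ g : G, (fun h => g * h * g⁻¹) '' (H₀ : Set G) ∧
              ApproximatesWithIndex ε (iterExp C (1 / ε)) A H₀ ∧
              0 < η ∧ 1 / η ≤ iterExp C (1 / ε) ∧ η ≤ ε ∧
              (H₀ : Set G) = stab η A ∧
              ∃ n l : ℕ, 1 ≤ n ∧ (n : ℝ) ≤ iterExp C (1 / ε) ∧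
                l ≤ n.choose ⌊ε * n⌋₊ ∧
                IsTranslateCombination n l A (H₀ : Set G)) := by
  obtain ⟨L, n₀, hL, hcore⟩ := IsKStable.exists_subgroup_of_growth k
  obtain ⟨M, hM⟩ := exists_poly_bound L k
  obtain ⟨C₁, hC₁⟩ := exists_poly_iterate_le (2 * L + 2) n₀
  obtain ⟨C₂, hC₂⟩ := exists_poly_comp_le M C₁
  obtain ⟨c₁, hc₁⟩ := exists_factorial_lt_iterExp L
  obtain ⟨c₂, hc₂⟩ := exists_poly_le_iterExp M
  -- The scale in (b) is reached after fewer than `n₀` blocks of `c₁` exponentials; the extra `c₁`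
  -- and `c₂` leave room for the index of the core and for polynomials in the scale.
  set C := C₁ + C₂ + c₂ + c₁ * (n₀ + 1) + 1 with hC
  refine ⟨C, by omega, fun G _ _ A hA ε hε hε1 => ?_⟩
  have hx : 1 ≤ 1 / ε := by rw [le_div_iff₀ hε]; linarith
  have hbound : ∀ Y : ℝ, 1 ≤ Y → 1 / ε ≤ Y →
      L * Y ^ L ≤ M * Y ^ M ∧ Y ≤ M * Y ^ M ∧
      L * Y ^ L + (L * Y ^ L + 1) ^ k + 1 / ε + 2 ≤ M * Y ^ M := by
    intro Y hY hεY
    have h := hM Y hY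
    have h₁ : 0 ≤ L * Y ^ L := by positivity
    have h₂ : 0 ≤ (L * Y ^ L + 1) ^ k := by positivity
    exact ⟨by linarith, by linarith, by linarith⟩
  have hηε : ∀ Y : ℝ, 1 / ε ≤ Y → 1 / Y ≤ ε := fun Y hY => by
    rw [one_div_le (by linarith) hε]
    exact hY
  constructor
  · obtain ⟨i, hi, hεY, H, D, F, hH, hidx, hD, hAD, hF, hFc, hsep⟩ := hcore hA
      (fun y => (2 * L + 2 : ℕ) * y ^ (2 * L + 2))
      (fun y hy => natCast_mul_pow_mono (by omega) hy) (1 / ε) hx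
    have hYC := hC₁ i hi _ hx
    set Y := (fun y : ℝ => ((2 * L + 2 : ℕ) : ℝ) * y ^ (2 * L + 2))^[i] (1 / ε) with hYdef
    have hY1 : 1 ≤ Y := hx.trans hεY
    have hCpos : (0 : ℝ) < C := by exact_mod_cast (by omega : 0 < C)
    have hMC : M * Y ^ M ≤ C * (1 / ε) ^ C :=
      (hC₂ _ _ hx (by linarith) hYC).trans (natCast_mul_pow_mono (by omega) hx)
    obtain ⟨h₁, h₂, h₃⟩ := hbound Y hY1 hεY
    obtain ⟨n, l, hn, hnle, hl, hcomb⟩ := hA.exists_combination_le_choose hF hsep hε hε1 hFc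
    refine ⟨H, 1 / Y, ?_, ?_, hηε Y hεY, hH, n, l, hn, hnle.trans (h₃.trans hMC), hl, hcomb⟩
    · rw [← mul_assoc] at hAD
      refine approximatesWithIndex_of_invariant hD hAD (hidx.trans (h₁.trans hMC)) ?_
      refine lt_of_lt_of_le ?_ (hηε Y hεY)
      have hLpow : L * Y ^ L * Y ≤ L * Y ^ (2 * L + 2) := by
        rw [mul_assoc, ← pow_succ]
        exact mul_le_mul_of_nonneg_left (pow_le_pow_right₀ hY1 (by omega)) L.cast_nonneg
      have hpos : 0 < Y ^ (2 * L + 2) := by positivity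
      rw [mul_one_div, div_mul_eq_mul_div, div_lt_div_iff₀ (by positivity) (by positivity)]
      have : H.index * Y ≤ L * Y ^ L * Y := by gcongr
      push_cast
      nlinarith
    · rw [div_le_div_iff₀ hCpos (by linarith), one_mul]
      have : Y ≤ C * (1 / ε) ^ C := h₂.trans hMC
      calc ε ^ C * Y ≤ ε ^ C * (C * (1 / ε) ^ C) := by gcongr
        _ = C := by rw [one_div, inv_pow]; field_simp
  · obtain ⟨i, hi, hεY, H, D, F, hH, hidx, hD, hAD, hF, hFc, hsep⟩ := hcore hA (iterExp c₁)
      (fun y hy => (hc₁ y hy).1) (1 / ε) hx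
    set Y := (iterExp c₁)^[i] (1 / ε) with hYdef
    have hY1 : 1 ≤ Y := hx.trans hεY
    have hle : ∀ d, d ≤ c₁ + c₂ → iterExp d Y ≤ iterExp C (1 / ε) := by
      intro d hd
      rw [hYdef, iterate_iterExp, ← iterExp_add]
      refine iterExp_le_iterExp ?_ hx
      have : c₁ * i + c₁ ≤ c₁ * (n₀ + 1) := by nlinarith
      omega
    have hMC : M * Y ^ M ≤ iterExp C (1 / ε) := (hc₂ Y hY1).trans (hle c₂ (by omega))
    obtain ⟨h₁, h₂, h₃⟩ := hbound Y hY1 hεY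
    obtain ⟨n, l, hn, hnle, hl, hcomb⟩ := hA.exists_combination_le_choose hF hsep hε hε1 hFc
    have hfac := (hc₁ Y hY1).2 _ hidx
    have hgpos : 0 < iterExp c₁ Y := zero_lt_one.trans_le (one_le_iterExp c₁ hY1)
    rw [← mul_assoc] at hAD
    -- Stated up to the factorial so that it applies both to the index of `H` and to that of its
    -- normal core.
    have hsmall : ∀ m : ℕ, m ≤ H.index.factorial → 2 * (1 / iterExp c₁ Y) * m < ε := by
      intro m hm
      refine lt_of_lt_of_le ?_ (hηε Y hεY)
      rw [mul_one_div, div_mul_eq_mul_div, div_lt_div_iff₀ hgpos (by positivity), one_mul]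
      refine lt_of_le_of_lt ?_ hfac
      gcongr
    have hcore_index := index_normalCore_le_factorial H
    refine ⟨H.normalCore, H.normalCore_normal, ?_, H, 1 / Y, coe_normalCore_eq_iInter H, ?_,
      by positivity, ?_, hηε Y hεY, hH, n, l, hn, hnle.trans (h₃.trans hMC), hl, hcomb⟩
    · refine approximatesWithIndex_of_invariant (fun c x hx' => hD c x (H.normalCore_le hx')) hAD
        ?_ (hsmall _ hcore_index)
      refine le_trans ?_ (hle c₁ (by omega))
      have : (H.normalCore.index : ℝ) ≤ H.index.factorial := by exact_mod_cast hcore_index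
      have : (0 : ℝ) ≤ H.index.factorial := Nat.cast_nonneg _
      nlinarith
    · exact approximatesWithIndex_of_invariant hD hAD (h₁.trans hMC |> hidx.trans)
        (hsmall _ (Nat.self_le_factorial _))
    · rw [one_div_one_div]
      exact h₂.trans hMC
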